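/- Let $E=L^\infty(\mathbb R)$ with the essential supremum norm and the almost everywhere order $\le$; inequalities and limits for elements of $E$ and for $a$ are understood up to null sets. Let $\varkappa,m>0$, let $0\le a\in L^1(\mathbb R)\cap L^\infty(\mathbb R)$ with $\int_{\mathbb R}a=1$, and let $G:E\to E$ be such that $Gv\ge0$ whenever $v\ge 0$. Write $(a*v)(x)=\int_{\mathbb R}a(x-y)v(y)\,dy$. Assume: (A1) $\beta:=\varkappa-m>0$; (A2) $\theta>0$ is such that $0=G0\le Gv\le G\theta=\beta$ for every $0\le v\le\theta$; (A3) there is $l_\theta>0$ with $\|Gv-Gw\|\le l_\theta\|v-w\|$ for all $0\le v,w\le\theta$; (A4) for some $p\ge0$, $\varkappa a*v-v\,Gv+pv\le\varkappa a*w-w\,Gw+pw$ for all $0\le v\le w\le\theta$. Let $u_0\in E$ with $0\le u_0\le\theta$ and $u_0\not\equiv0$ in the sense that $u_0\ge\delta>0$ on some interval of positive length. Let $u:[0,\infty)\to E$ be a nonnegative classical solution (continuous on $[0,\infty)$ and continuously differentiable on $(0,\infty)$ in the norm of $E$) of $$\frac{\partial u}{\partial t}=\varkappa\,(a*u)-mu-u\,Gu,\qquad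 u(\cdot,0)=u_0 .$$ Definitions. Let $b:\mathbb R\to[0,\infty)$. - $b$ is *tail-decreasing* (*tail-continuous*) if, for some $\rho\ge0$, $b>0$ on $(\rho,\infty)$ and $b$ is strictly decreasing to $0$ (respectively, continuous) on $(\rho,\infty)$. It is *long-tailed* if $b>0$ on some $[\rho,\infty)$, $\rho\ge0$, and $b(x+y)/b(x)\to1$ as $x\to\infty$ for every $y\ge0$. - $b$ is *sub-exponential in the sense of densities* if $b\in L^1([0,\infty))\cap L^\infty([0,\infty))$, $b$ is long-tailed, and $\int_0^x b(x-y)b(y)\,dy\sim2\bigl(\int_0^\infty b(y)\,dy\bigr)b(x)$ as $x\to\infty$. - A bounded nonincreasing $b$ on $\mathbb R$ with $\lim_{x\to\infty}b(x)=0$ is *sub-exponential in the sense of distributions* if the probability distribution on $[0,\infty)$ with distribution function $F(x)=1_{[0,\infty)}(x)\bigl(1-b(x)/b(-\infty)\bigr)$ (made right-continuous) is sub-exponential: $1-(F*F)(x)\sim2\,(1-F(x))$ as $x\to\infty$, where $F*F$ is the distribution function of the sum of two independent random variables with distribution function $F$. - $\mathcal S(\mathbb R_+)$ is the set of bounded $b$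 which are sub-exponential in the sense of densities, tail-decreasing and tail-continuous; $\mathcal S(\mathbb R)$ is the set of $b$ for which both $b(x)$ and $b(-x)$ belong to $\mathcal S(\mathbb R_+)$. - $\mathcal{MS}(\mathbb R)$ is the set of bounded nonincreasing $b$ on $\mathbb R$ with $\lim_{x\to\infty}b(x)=0$ which are sub-exponential in the sense of distributions, tail-decreasing and tail-continuous. - For $b$ tail-decreasing and tail-continuous, and large $t$, $r(t,b)$ denotes the solution of $b(r(t,b))=e^{-\beta t}$ with $r(t,b)\to\infty$ as $t\to\infty$ (it is unique for large $t$). Similarly, if $b(-x)$ has these properties, $b(-l(t,b))=e^{-\beta t}$ with $l(t,b)\to\infty$. Theorem. Let $b:\mathbb R\to[0,\infty)$, and suppose that one of the following holds: (C1) $\lim_{x\to\pm\infty}u_0(x)=0$, $b\in\mathcal S(\mathbb R)$, and, for some $\rho>0$, $\max\{a(x),u_0(x)\}\le b(x)$ for $|x|>\rho$; in this case put $\Lambda^+_\varepsilon(t,b)=[-l(t+\varepsilon t,b),\,r(t+\varepsilon t,b)]$; (C2) $\lim_{x\to\infty}u_0(x)=0$ and $\inf_{x\le-\rho_0}u_0(x)>0$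 for some $\rho_0\ge0$, $b\in\mathcal{MS}(\mathbb R)$, and, for some $\rho>0$, $\max\bigl\{\int_x^\infty a(y)\,dy,\,u_0(x)\bigr\}\le b(x)$ for $x>\rho$; in this case put $\Lambda^+_\varepsilon(t,b)=(-\infty,\,r(t+\varepsilon t,b)]$. Then, for each $\varepsilon\in(0,1)$, $$\lim_{t\to\infty}\ \operatorname*{ess\,sup}_{x\in\mathbb R\setminus\Lambda^+_\varepsilon(t,b)}u(x,t)=0 .$$ -/

import Mathlib

open MeasureTheory Filter Topology Set

noncomputable section

namespace AccelFront

/-- The space `E = L^∞(ℝ)` with its essential supremum norm and its almost everywhere order. -/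
abbrev E : Type := Lp ℝ ⊤ (volume : Measure ℝ)

/-- The constant function `c`, as an element of `E`. -/
def constE (c : ℝ) : E := (memLp_top_const c).toLp (fun _ : ℝ => c)

/-- The convolution `(a * v)(x) = ∫ a(x - y) v(y) dy`. -/
def convol (a v : ℝ → ℝ) (x : ℝ) : ℝ := ∫ y, a (x - y) * v y

/-! ### The equation -/

/-- Standing assumptions on the data of the equation: `ϰ, m > 0`, the kernel `a` is a bounded
probability density, and `G` maps nonnegative functions to nonnegative functions. -/
structure Data (κ m : ℝ) (a : ℝ → ℝ) (G : E → E) : Prop where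
  kappa_pos : 0 < κ
  m_pos : 0 < m
  a_nonneg : ∀ᵐ x, 0 ≤ a x
  a_integrable : Integrable a
  a_bounded : MemLp a ⊤
  a_integral : ∫ x, a x = 1
  G_nonneg : ∀ v : E, 0 ≤ v → 0 ≤ G v

/-- A nonnegative classical solution `u : [0, ∞) → E` of
`∂u/∂t = ϰ (a * u) - m u - u G(u)`, `u(0) = u₀` (values of `u` at negative times play no role):
continuous on `[0, ∞)` and continuously differentiable on `(0, ∞)` in the norm of `E`. -/
structure IsSolution (κ m : ℝ) (a : ℝ → ℝ) (G : E → E) (u₀ : E) (u : ℝ → E) : Prop where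
  initial : u 0 = u₀
  nonneg : ∀ t, 0 ≤ t → 0 ≤ u t
  continuousOn : ContinuousOn u (Ici 0)
  exists_deriv : ∃ u' : ℝ → E, ContinuousOn u' (Ioi 0) ∧ ∀ t, 0 < t →
    HasDerivAt u (u' t) t ∧
    ∀ᵐ x, u' t x = κ * convol a (u t) x - m * u t x - u t x * G (u t) x

/-- `β = ϰ - m > 0`. -/
def GrowthPos (κ m : ℝ) : Prop := 0 < κ - m

/-- For a given `θ > 0`: `0 = G 0 ≤ G v ≤ G θ = β` for `0 ≤ v ≤ θ`, where `β = ϰ - m`. -/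
def GBounds (κ m : ℝ) (G : E → E) (θ : ℝ) : Prop :=
  0 < θ ∧ G 0 = 0 ∧ G (constE θ) = constE (κ - m) ∧
    ∀ v : E, 0 ≤ v → v ≤ constE θ → 0 ≤ G v ∧ G v ≤ constE (κ - m)

/-- `G` is Lipschitz continuous on `{0 ≤ v ≤ θ}`. -/
def GLipschitz (G : E → E) (θ : ℝ) : Prop :=
  ∃ l : ℝ, 0 < l ∧ ∀ v w : E, 0 ≤ v → v ≤ constE θ → 0 ≤ w → w ≤ constE θ →
    ‖G v - G w‖ ≤ l * ‖v - w‖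

/-- For some `p ≥ 0`, the map `v ↦ ϰ (a * v) - v G(v) + p v` is monotone on
`{0 ≤ v ≤ θ}`. -/
def GComparison (κ : ℝ) (a : ℝ → ℝ) (G : E → E) (θ : ℝ) : Prop :=
  ∃ p : ℝ, 0 ≤ p ∧ ∀ v w : E, 0 ≤ v → v ≤ w → w ≤ constE θ → ∀ᵐ x,
    κ * convol a v x - v x * G v x + p * v x ≤ κ * convol a w x - w x * G w x + p * w x

/-- `u₀ ≢ 0`, in the sense that `u₀ ≥ δ > 0` almost everywhere on some interval. -/
def Nontriv (u₀ : E) : Prop :=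
  ∃ δ ρ x₀ : ℝ, 0 < δ ∧ 0 < ρ ∧ ∀ᵐ x, x ∈ Icc (x₀ - ρ) (x₀ + ρ) → δ ≤ u₀ x

/-- `u₀(x) → 0` as `x → ±∞` (up to a null set, since `u₀ ∈ L^∞`). -/
def DecayBoth (u₀ : E) : Prop :=
  Tendsto u₀ (atTop ⊓ ae volume) (𝓝 0) ∧ Tendsto u₀ (atBot ⊓ ae volume) (𝓝 0)

/-- `u₀(x) → 0` as `x → ∞`, and the (essential) infimum of `u₀` over some half-line
`(-∞, -ρ]` is positive. -/
def DecayRight (u₀ : E) : Prop :=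
  Tendsto u₀ (atTop ⊓ ae volume) (𝓝 0) ∧
    ∃ ρ : ℝ, 0 ≤ ρ ∧ ∃ δ : ℝ, 0 < δ ∧ ∀ᵐ x, x ≤ -ρ → δ ≤ u₀ x

/-! ### Classes of heavy-tailed functions -/

/-- Right-side long-tailed functions. -/
def LongTailed (b : ℝ → ℝ) : Prop :=
  (∃ ρ : ℝ, 0 ≤ ρ ∧ ∀ x, ρ ≤ x → 0 < b x) ∧
    ∀ y : ℝ, 0 ≤ y → Tendsto (fun x => b (x + y) / b x) atTop (𝓝 1)

/-- Right-side tail-decreasing functions: positive and strictly decreasing to `0` on some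
`(ρ, ∞)`. -/
def TailDecreasing (b : ℝ → ℝ) : Prop :=
  (∃ ρ : ℝ, 0 ≤ ρ ∧ (∀ x, ρ < x → 0 < b x) ∧ StrictAntiOn b (Ioi ρ)) ∧ Tendsto b atTop (𝓝 0)

/-- Right-side tail-continuous functions: positive and continuous on some `(ρ, ∞)`. -/
def TailContinuous (b : ℝ → ℝ) : Prop :=
  ∃ ρ : ℝ, 0 ≤ ρ ∧ (∀ x, ρ < x → 0 < b x) ∧ ContinuousOn b (Ioi ρ)

/-- Sub-exponential functions on `[0, ∞)` in the sense of densities. -/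
def SubexpDensity (b : ℝ → ℝ) : Prop :=
  IntegrableOn b (Ici 0) ∧ MemLp b ⊤ (volume.restrict (Ici 0)) ∧ LongTailed b ∧
    Asymptotics.IsEquivalent atTop (fun x => ∫ y in (0 : ℝ)..x, b (x - y) * b y)
      (fun x => 2 * (∫ y in Ici (0 : ℝ), b y) * b x)

/-- The measure `ν` on `[0, ∞)` with tail `b`: it is the image under `y ↦ max y 0` of the
Lebesgue-Stieltjes measure `-db` on `ℝ`. If the nonincreasing function `b` tends to `0` at `∞`,
then `ν` has total mass `b(-∞)`, and `ν((x, ∞)) = b(x)` at all continuity points `x > 0` of `b`.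
So `ν / b(-∞)` is the probability measure with distribution function
`1_{[0,∞)}(x) (1 - b(x) / b(-∞))` (modified at jumps of `b` to be right-continuous). -/
def halfLineMeasure (b : ℝ → ℝ) (hb : Antitone b) : Measure ℝ :=
  (hb.neg.stieltjesFunction.measure).map (fun y => max y 0)

/-- Sub-exponential functions in the sense of distributions, for a bounded nonincreasing `b` on
`ℝ` with `b(∞) = 0`: the probability distribution `F(x) = 1_{[0,∞)}(x) (1 - b(x) / b(-∞))` on
`[0, ∞)` is sub-exponential, that is, `1 - (F * F)(x) ∼ 2 (1 - F(x))` as `x → ∞`. Here this is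
multiplied by `b(-∞)²`, and `b(-∞) = sup b`. -/
def SubexpDistr (b : ℝ → ℝ) : Prop :=
  BddAbove (range b) ∧ Tendsto b atTop (𝓝 0) ∧ ∃ hb : Antitone b,
    Asymptotics.IsEquivalent atTop
      (fun x => ((halfLineMeasure b hb).conv (halfLineMeasure b hb)).real (Ioi x))
      (fun x => 2 * (⨆ y, b y) * b x)

/-- The class `𝒮(ℝ₊)`: bounded, sub-exponential in the sense of densities, tail-decreasing and
tail-continuous. -/
def ClassSPlus (b : ℝ → ℝ) : Prop :=
  BddAbove (range b) ∧ SubexpDensity b ∧ TailDecreasing b ∧ TailContinuous b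

/-- The class `𝒮(ℝ)`: both `b(x)` and `b(-x)` are in `𝒮(ℝ₊)`. -/
def ClassS (b : ℝ → ℝ) : Prop := ClassSPlus b ∧ ClassSPlus (fun x => b (-x))

/-- The class `ℳ𝒮(ℝ)`: bounded, nonincreasing on `ℝ`, tending to `0` at `∞`, sub-exponential in
the sense of distributions, tail-decreasing and tail-continuous. -/
def ClassMS (b : ℝ → ℝ) : Prop :=
  BddAbove (range b) ∧ Antitone b ∧ Tendsto b atTop (𝓝 0) ∧ SubexpDistr b ∧
    TailDecreasing b ∧ TailContinuous b

/-! ### The fronts -/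

/-- `r(t, b)`: the solution of `b(r) = e^{-β t}` on the right tail of `b`. For tail-decreasing and
tail-continuous `b` and large `t` it is the largest solution on `ℝ`, see `isGreatest_rightFront`
and `rightFront_spec`. -/
def rightFront (β : ℝ) (b : ℝ → ℝ) (t : ℝ) : ℝ := sSup {x | b x = Real.exp (-(β * t))}

/-- `l(t, b)`: the solution of `b(-l) = e^{-β t}` on the left tail of `b`. -/
def leftFront (β : ℝ) (b : ℝ → ℝ) (t : ℝ) : ℝ := rightFront β (fun x => b (-x)) t

theorem isGreatest_rightFront {β : ℝ} {b : ℝ → ℝ} (hβ : 0 < β) (hd : TailDecreasing b)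
    (hc : TailContinuous b) (M : ℝ) : ∀ᶠ t in atTop, M < rightFront β b t ∧
      IsGreatest {x | b x = Real.exp (-(β * t))} (rightFront β b t) := by
  obtain ⟨⟨ρ₁, -, hpos, hanti⟩, hlim⟩ := hd
  obtain ⟨ρ₂, -, -, hcont⟩ := hc
  set N : ℝ := max M (max ρ₁ ρ₂) + 1 with hN
  have hNM : M < N := by have := le_max_left M (max ρ₁ ρ₂); linarith
  have hN1 : ρ₁ < N := by
    have := (le_max_left ρ₁ ρ₂).trans (le_max_right M (max ρ₁ ρ₂)); linarith
  have hN2 : ρ₂ < N := by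
    have := (le_max_right ρ₁ ρ₂).trans (le_max_right M (max ρ₁ ρ₂)); linarith
  have hexp : Tendsto (fun t => Real.exp (-(β * t))) atTop (𝓝 0) :=
    Real.tendsto_exp_neg_atTop_nhds_zero.comp (tendsto_id.const_mul_atTop hβ)
  filter_upwards [hexp.eventually (gt_mem_nhds (hpos N hN1))] with t ht
  obtain ⟨X, hX, hXN⟩ :=
    ((hlim.eventually (gt_mem_nhds (Real.exp_pos (-(β * t))))).and (eventually_ge_atTop N)).exists
  have hcc : ContinuousOn b (Icc N X) := hcont.mono fun y hy => lt_of_lt_of_le hN2 hy.1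
  obtain ⟨x, hx, hxe⟩ := intermediate_value_Icc' hXN hcc ⟨hX.le, ht.le⟩
  have hxN : N < x := by
    rcases hx.1.lt_or_eq with h | h
    · exact h
    · rw [← h] at hxe; linarith
  have hg : IsGreatest {x | b x = Real.exp (-(β * t))} x := by
    refine ⟨hxe, fun y hy => ?_⟩
    by_contra hlt
    have hlt' : x < y := not_le.mp hlt
    have h1 : b y < b x := hanti (hN1.trans hxN) ((hN1.trans hxN).trans hlt') hlt'
    have h2 : b y = Real.exp (-(β * t)) := hy
    linarith
  have he : rightFront β b t = x := hg.csSup_eq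
  rw [he]
  exact ⟨hNM.trans hxN, hg⟩

/-- `r(t, b)` is, up to its values at bounded times, the only function which tends to `∞` and
solves `b(r(t)) = e^{-β t}` for all large `t`. -/
theorem rightFront_spec {β : ℝ} {b : ℝ → ℝ} (hβ : 0 < β) (hd : TailDecreasing b)
    (hc : TailContinuous b) (r : ℝ → ℝ) :
    (Tendsto r atTop atTop ∧ ∀ᶠ t in atTop, b (r t) = Real.exp (-(β * t))) ↔
      ∀ᶠ t in atTop, r t = rightFront β b t := by
  have key := isGreatest_rightFront hβ hd hc
  have htend : Tendsto (rightFront β b) atTop atTop :=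
    tendsto_atTop.2 fun M => (key M).mono fun t ht => ht.1.le
  constructor
  · rintro ⟨hr, hbr⟩
    obtain ⟨⟨ρ, -, -, hanti⟩, -⟩ := hd
    filter_upwards [hr.eventually_gt_atTop ρ, hbr, key ρ] with t h1 h2 h3
    exact hanti.injOn h1 h3.1 (h2.trans h3.2.1.symm)
  · intro h
    refine ⟨htend.congr' (h.mono fun t ht => ht.symm), ?_⟩
    filter_upwards [h, key 0] with t h1 h2
    rw [h1]
    exact h2.2.1

end AccelFront

end

open AccelFront

namespace AccelFront

/-! Since `u` and `G u` are nonnegative, `u` is a subsolution of the linear equation `∂u/∂t = ϰ (a *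
u) - m u`. If a bounded profile `ω ≥ 0` satisfies `a * ω ≤ (1 + δ) ω` and `u₀ ≤ C ω`, then `C exp((ϰ
(1 + δ) - m) t) ω` is a supersolution, so it bounds `u` (`solution_le_of_convol_le`). Take `δ = β ε
/ (2 ϰ)`, which makes the growth rate `β + β ε / 2`. Ahead of the front `ω ≤ b ≤ exp(-β (1 + ε) t)`,
hence `u ≤ C exp(-β ε t / 2)` there (`tendsto_essSup_of_profile`).

What remains is to build `ω`, equal to `b` or below it far out and constant near the origin or on a
left half-line. The inequality `a * ω ≤ (1 + δ) ω` in the tail is where sub-exponentiality enters: a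
sum of two independent variables is large essentially because one of them is, so the part of the
convolution in which both are large is negligible compared with `b`, and a shift by a fixed amount
does not change `b` much. This is `exists_convol_le_of_subexpDensity` for densities and
`exists_convol_le_of_classMS` for distributions. -/

theorem ae_norm_le (v : E) : ∀ᵐ x, ‖v x‖ ≤ ‖v‖ := by
  have h := ae_le_eLpNormEssSup (f := v) (μ := (volume : Measure ℝ))
  filter_upwards [h] with x hx
  rw [Lp.norm_def, eLpNorm_exponent_top]
  have hfin : eLpNormEssSup v (volume : Measure ℝ) ≠ ⊤ := by
    have := Lp.eLpNorm_ne_top v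
    rwa [eLpNorm_exponent_top] at this
  have := ENNReal.toReal_mono hfin hx
  simpa using this

theorem coeFn_constE (c : ℝ) : ⇑(constE c) =ᵐ[volume] fun _ => c := MemLp.coeFn_toLp _

/-! ### Convolution with an integrable kernel -/

section Convolution

variable {a f g : ℝ → ℝ} {C D : ℝ}

theorem ae_sub_left {p : ℝ → Prop} (h : ∀ᵐ y, p y) (x : ℝ) : ∀ᵐ y, p (x - y) :=
  (quasiMeasurePreserving_sub_left volume x).ae h

theorem integrable_convol (ha : Integrable a) (hf : AEStronglyMeasurable f volume)
    (hC : ∀ᵐ y, ‖f y‖ ≤ C) (x : ℝ) : Integrable (fun y => a (x - y) * f y) :=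
  (ha.comp_sub_left x).mul_bdd hf hC

theorem integrable_convol_coeFn (ha : Integrable a) (v : E) (x : ℝ) :
    Integrable (fun y => a (x - y) * v y) :=
  integrable_convol ha (Lp.aestronglyMeasurable v) (ae_norm_le v) x

theorem convol_congr_ae (h : f =ᵐ[volume] g) (x : ℝ) : convol a f x = convol a g x :=
  integral_congr_ae (by filter_upwards [h] with y hy; rw [hy])

theorem convol_const (C x : ℝ) : convol a (fun _ => C) x = (∫ y, a y) * C := by
  unfold convol
  rw [integral_mul_const, integral_sub_left_eq_self]

theorem convol_mono (ha0 : ∀ᵐ x, 0 ≤ a x) {x : ℝ} (hf : Integrable (fun y => a (x - y) * f y))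
    (hg : Integrable (fun y => a (x - y) * g y)) (h : f ≤ᵐ[volume] g) :
    convol a f x ≤ convol a g x := by
  refine integral_mono_ae hf hg ?_
  filter_upwards [h, ae_sub_left ha0 x] with y hy hay
  exact mul_le_mul_of_nonneg_left hy hay

theorem convol_smul_sub_smul (ha : Integrable a) (v w : E) (c d x : ℝ) :
    convol a (c • v - d • w : E) x = c * convol a v x - d * convol a w x := by
  have h : ⇑(c • v - d • w) =ᵐ[volume] fun y => c * v y - d * w y := by
    filter_upwards [Lp.coeFn_sub (c • v) (d • w), Lp.coeFn_smul c v, Lp.coeFn_smul d w]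
      with y h1 h2 h3
    rw [h1, Pi.sub_apply, h2, h3]
    rfl
  rw [convol_congr_ae h]
  unfold convol
  rw [← integral_const_mul, ← integral_const_mul, ← integral_sub
    ((integrable_convol_coeFn ha v x).const_mul c) ((integrable_convol_coeFn ha w x).const_mul d)]
  congr 1
  ext y
  ring

theorem convol_neg_comp (f : ℝ → ℝ) (x : ℝ) :
    convol (fun z => a (-z)) (fun z => f (-z)) (-x) = convol a f x := by
  unfold convol
  rw [← integral_neg_eq_self (fun y => a (x - y) * f y)]
  congr 1
  ext y
  dsimp only
  rw [show -(-x - y) = x - -y by ring]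

end Convolution

/-! ### Monotonicity of curves in `L^∞` -/

theorem integrableOn_coeFn {s : Set ℝ} (hs : volume s ≠ ⊤) (v : E) : IntegrableOn v s := by
  have : IsFiniteMeasure (volume.restrict s) := ⟨by simpa using hs.lt_top⟩
  exact ((Lp.memLp v).restrict s).integrable le_top

/-- Integration over a set of finite measure, as a continuous functional on `L^∞`. -/
noncomputable def setIntegralCLM (s : Set ℝ) (hs : volume s ≠ ⊤) : E →L[ℝ] ℝ :=
  LinearMap.mkContinuous
    { toFun := fun v => ∫ x in s, v x
      map_add' := fun v w => by
        rw [← integral_add (integrableOn_coeFn hs v) (integrableOn_coeFn hs w)]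
        exact integral_congr_ae (ae_restrict_of_ae (Lp.coeFn_add v w))
      map_smul' := fun c v => by
        rw [RingHom.id_apply, ← integral_smul]
        exact integral_congr_ae (ae_restrict_of_ae (Lp.coeFn_smul c v)) }
    (volume.real s) fun v => by
      rw [mul_comm]
      exact norm_setIntegral_le_of_norm_le_const_ae hs.lt_top
        (ae_restrict_of_ae (ae_norm_le v))

theorem nonneg_of_setIntegralCLM_nonneg {v : E}
    (h : ∀ s (hs : volume s ≠ ⊤), 0 ≤ setIntegralCLM s hs v) : 0 ≤ v := by
  rw [← Lp.coeFn_nonneg]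
  -- `v` need not be integrable on `ℝ`, so its sign is read off on bounded intervals.
  have : ∀ᵐ x, ∀ n : ℕ, x ∈ Icc (-n : ℝ) n → 0 ≤ v x := by
    refine ae_all_iff.2 fun n => ?_
    rw [← ae_restrict_iff' measurableSet_Icc]
    have hn : volume (Icc (-n : ℝ) n) ≠ ⊤ := by simp
    refine ae_nonneg_of_forall_setIntegral_nonneg (integrableOn_coeFn hn v) fun s hs _ => ?_
    rw [Measure.restrict_restrict hs]
    exact h (s ∩ Icc (-n : ℝ) n) (measure_ne_top_of_subset inter_subset_right hn)
  filter_upwards [this] with x hx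
  obtain ⟨n, hn⟩ := exists_nat_ge |x|
  exact hx n (abs_le.1 hn)

/-- Integrals over sets of finite measure detect the order of `L^∞`, so testing against them reduces
the claim to real functions with nonnegative derivative. -/
theorem le_of_hasDerivAt_nonneg {f f' : ℝ → E} {T : ℝ} (hT : 0 ≤ T)
    (hc : ContinuousOn f (Icc 0 T)) (hd : ∀ t ∈ Ioo 0 T, HasDerivAt f (f' t) t)
    (hf' : ∀ t ∈ Ioo 0 T, 0 ≤ f' t) : f 0 ≤ f T := by
  rw [← sub_nonneg]
  refine nonneg_of_setIntegralCLM_nonneg fun s hs => ?_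
  set L := setIntegralCLM s hs
  have hderiv : ∀ t ∈ Ioo 0 T, HasDerivAt (fun t => L (f t)) (L (f' t)) t := fun t ht =>
    L.hasFDerivAt.comp_hasDerivAt t (hd t ht)
  have hmono : MonotoneOn (fun t => L (f t)) (Icc 0 T) := by
    refine monotoneOn_of_deriv_nonneg (convex_Icc 0 T) (L.continuous.comp_continuousOn hc) ?_ ?_
    · rw [interior_Icc]
      exact fun t ht => (hderiv t ht).differentiableAt.differentiableWithinAt
    · rw [interior_Icc]
      intro t ht
      rw [(hderiv t ht).deriv]
      exact integral_nonneg_of_ae (ae_restrict_of_ae ((Lp.coeFn_nonneg _).2 (hf' t ht)))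
  have := hmono (left_mem_Icc.2 hT) (right_mem_Icc.2 hT) hT
  rw [map_sub, sub_nonneg]
  exact this

/-! ### Comparison principle for the linear equation -/

section Comparison

variable {κ : ℝ} {a : ℝ → ℝ} {v v' : ℝ → E}

theorem nonneg_smul_constE_one {c : ℝ} (hc : 0 ≤ c) : 0 ≤ c • constE 1 := by
  rw [← Lp.coeFn_nonneg]
  filter_upwards [Lp.coeFn_smul c (constE 1), coeFn_constE 1] with x h1 h2
  rw [h1, Pi.smul_apply, h2]
  simpa using hc

theorem add_smul_constE_nonneg_iff (w : E) (c : ℝ) :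
    0 ≤ w + c • constE 1 ↔ ∀ᵐ x, -c ≤ w x := by
  rw [← Lp.coeFn_nonneg]
  have h : ∀ᵐ x, (w + c • constE 1 : E) x = w x + c := by
    filter_upwards [Lp.coeFn_add w (c • constE 1), Lp.coeFn_smul c (constE 1), coeFn_constE 1]
      with x h1 h2 h3
    rw [h1, Pi.add_apply, h2, Pi.smul_apply, h3]
    simp
  constructor <;> intro H <;> filter_upwards [H, h] with x hx h1
  · rw [Pi.zero_apply, h1] at hx
    linarith
  · rw [Pi.zero_apply, h1]
    linarith

/-- One Picard-type step: `v ≥ -M exp(2ϰt)` and `∫ a = 1` give `v' ≥ -ϰ M exp(2ϰt)`, and the rate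
`2ϰ` in the exponential makes integration in time gain a factor `1/2`. -/
theorem lower_bound_halves (hκ : 0 ≤ κ) (ha : Integrable a) (ha0 : ∀ᵐ x, 0 ≤ a x)
    (ha1 : ∫ x, a x = 1) (hc : ContinuousOn v (Ici 0)) (hd : ∀ t, 0 < t → HasDerivAt v (v' t) t)
    (hge : ∀ t, 0 < t → ∀ᵐ x, κ * convol a (v t) x ≤ v' t x) (h0 : 0 ≤ v 0) {T M : ℝ}
    (hM : 0 ≤ M)
    (h : ∀ t ∈ Icc 0 T, 0 ≤ v t + (M * Real.exp (2 * κ * t)) • constE 1) :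
    ∀ t ∈ Icc 0 T, 0 ≤ v t + (M / 2 * Real.exp (2 * κ * t)) • constE 1 := by
  intro t ht
  set e : ℝ → ℝ := fun s => M / 2 * Real.exp (2 * κ * s)
  set e' : ℝ → ℝ := fun s => κ * (M * Real.exp (2 * κ * s))
  have he : ∀ s, HasDerivAt e (e' s) s := fun s => by
    have h1 : HasDerivAt (fun s => 2 * κ * s) (2 * κ) s := by
      simpa using (hasDerivAt_id s).const_mul (2 * κ)
    refine (h1.exp.const_mul (M / 2)).congr_deriv ?_
    ring
  have hec : Continuous e := continuous_iff_continuousAt.2 fun s => (he s).continuousAt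
  have key : v 0 + e 0 • constE 1 ≤ v t + e t • constE 1 := by
    refine le_of_hasDerivAt_nonneg (f := fun s => v s + e s • constE 1)
      (f' := fun s => v' s + e' s • constE 1) ht.1 ?_ ?_ ?_
    · exact (hc.mono Icc_subset_Ici_self).add (hec.continuousOn.smul continuousOn_const)
    · exact fun s hs => (hd s hs.1).add ((he s).smul_const _)
    · intro s hs
      rw [add_smul_constE_nonneg_iff]
      have hb := (add_smul_constE_nonneg_iff _ _).1 (h s ⟨hs.1.le, hs.2.le.trans ht.2⟩)
      filter_upwards [hge s hs.1] with x hx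
      have h1 : convol a (fun _ => -(M * Real.exp (2 * κ * s))) x ≤ convol a (v s) x :=
        convol_mono ha0 ((ha.comp_sub_left x).mul_const _) (integrable_convol_coeFn ha _ x) hb
      rw [convol_const, ha1, one_mul] at h1
      have h2 := mul_le_mul_of_nonneg_left h1 hκ
      simp only [e']
      linarith
  refine le_trans (add_nonneg h0 (nonneg_smul_constE_one ?_)) key
  positivity

/-- Starting from `M = sup ‖v‖` on `[0, T]`, repeated halving gives the lower bounds `-M / 2 ^ n *
exp(2ϰt)`, which tend to `0`. -/
theorem nonneg_of_convol_le_deriv (hκ : 0 ≤ κ) (ha : Integrable a) (ha0 : ∀ᵐ x, 0 ≤ a x)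
    (ha1 : ∫ x, a x = 1) (hc : ContinuousOn v (Ici 0)) (hd : ∀ t, 0 < t → HasDerivAt v (v' t) t)
    (hge : ∀ t, 0 < t → ∀ᵐ x, κ * convol a (v t) x ≤ v' t x) (h0 : 0 ≤ v 0) {T : ℝ}
    (hT : 0 ≤ T) : 0 ≤ v T := by
  obtain ⟨M, hM⟩ := isCompact_Icc.exists_bound_of_continuousOn
    (hc.mono (fun y hy => hy.1 : Icc 0 T ⊆ Ici 0))
  have hM0 : 0 ≤ M := (norm_nonneg _).trans (hM 0 (left_mem_Icc.2 hT))
  have hall : ∀ n : ℕ, ∀ t ∈ Icc 0 T,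
      0 ≤ v t + (M / 2 ^ n * Real.exp (2 * κ * t)) • constE 1 := by
    intro n
    induction n with
    | zero =>
      intro t ht
      rw [add_smul_constE_nonneg_iff]
      filter_upwards [ae_norm_le (v t)] with x hx
      have h1 : 1 ≤ Real.exp (2 * κ * t) := Real.one_le_exp (by have := ht.1; positivity)
      have h2 := neg_le_of_abs_le (hx.trans (hM t ht))
      have h3 := le_mul_of_one_le_right hM0 h1
      simp only [pow_zero, div_one]
      linarith
    | succ n ih =>
      intro t ht
      have := lower_bound_halves hκ ha ha0 ha1 hc hd hge h0 (by positivity) ih t ht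
      rwa [div_div, ← pow_succ] at this
  have hlim : Tendsto (fun n : ℕ => v T + (M / 2 ^ n * Real.exp (2 * κ * T)) • constE 1) atTop
      (𝓝 (v T + (0 * Real.exp (2 * κ * T)) • constE 1)) := by
    refine tendsto_const_nhds.add (Tendsto.smul_const (Tendsto.mul_const _ ?_) _)
    exact tendsto_const_nhds.div_atTop (tendsto_pow_atTop_atTop_of_one_lt one_lt_two)
  have := ge_of_tendsto' hlim fun n => hall n T (right_mem_Icc.2 hT)
  simpa using this

end Comparison

/-- A function `ω` with `a * ω ≤ (1 + δ) ω` yields an exponentially growing upper bound for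
solutions whose initial values are bounded by a multiple of `ω`. -/
theorem solution_le_of_convol_le {κ m : ℝ} {a : ℝ → ℝ} {G : E → E} {u₀ : E} {u : ℝ → E}
    (hdata : Data κ m a G) (hu : IsSolution κ m a G u₀ u) {ω : E} {C δ : ℝ} (hC : 0 ≤ C)
    (hω : ∀ᵐ x, convol a ω x ≤ (1 + δ) * ω x) (h0 : u₀ ≤ C • ω) {t : ℝ} (ht : 0 ≤ t) :
    u t ≤ (C * Real.exp ((κ * (1 + δ) - m) * t)) • ω := by
  obtain ⟨u', -, hu'⟩ := hu.exists_deriv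
  -- The factor `q` cancels the term `-m u`, and `p` is chosen so that `v = p ω - q u` satisfies `v'
  -- ≥ ϰ (a * v)`.
  set p : ℝ → ℝ := fun s => C * Real.exp (κ * (1 + δ) * s)
  set q : ℝ → ℝ := fun s => Real.exp (m * s)
  have hp : ∀ s, HasDerivAt p (κ * (1 + δ) * p s) s := fun s => by
    have h1 : HasDerivAt (fun s => κ * (1 + δ) * s) (κ * (1 + δ)) s := by
      simpa using (hasDerivAt_id s).const_mul (κ * (1 + δ))
    refine (h1.exp.const_mul C).congr_deriv ?_
    ring
  have hq : ∀ s, HasDerivAt q (m * q s) s := fun s => by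
    have h1 : HasDerivAt (fun s => m * s) m s := by
      simpa using (hasDerivAt_id s).const_mul m
    exact h1.exp.congr_deriv (mul_comm _ _)
  have hpc : Continuous p := continuous_iff_continuousAt.2 fun s => (hp s).continuousAt
  have hqc : Continuous q := continuous_iff_continuousAt.2 fun s => (hq s).continuousAt
  have key : 0 ≤ p t • ω - q t • u t := by
    refine nonneg_of_convol_le_deriv (v := fun s => p s • ω - q s • u s)
      (v' := fun s => (κ * (1 + δ) * p s) • ω - (q s • u' s + (m * q s) • u s))
      hdata.kappa_pos.le hdata.a_integrable hdata.a_nonneg hdata.a_integral ?_ ?_ ?_ ?_ ht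
    · exact (hpc.continuousOn.smul continuousOn_const).sub
        (hqc.continuousOn.smul hu.continuousOn)
    · exact fun s hs => ((hp s).smul_const ω).sub ((hq s).smul (hu' s hs).1)
    · intro s hs
      have hs0 := hu.nonneg s hs.le
      filter_upwards [hω, (hu' s hs).2, (Lp.coeFn_nonneg _).2 hs0,
        (Lp.coeFn_nonneg _).2 (hdata.G_nonneg _ hs0),
        Lp.coeFn_sub ((κ * (1 + δ) * p s) • ω) (q s • u' s + (m * q s) • u s),
        Lp.coeFn_add (q s • u' s) ((m * q s) • u s),
        Lp.coeFn_smul (κ * (1 + δ) * p s) ω, Lp.coeFn_smul (q s) (u' s),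
        Lp.coeFn_smul (m * q s) (u s)] with x h1 h2 h3 h4 h5 h6 h7 h8 h9
      rw [convol_smul_sub_smul hdata.a_integrable, h5, Pi.sub_apply, h6, Pi.add_apply, h7, h8, h9]
      simp only [Pi.smul_apply, smul_eq_mul, Pi.zero_apply] at *
      rw [h2]
      have hp0 : 0 ≤ p s := by simp only [p]; positivity
      have hq0 : 0 ≤ q s := (Real.exp_pos _).le
      -- The difference `v' - ϰ (a * v)` is exactly the sum of the two terms `e1` and `e2`.
      have e1 : 0 ≤ q s * (u s x * G (u s) x) := mul_nonneg hq0 (mul_nonneg h3 h4)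
      have e2 : 0 ≤ κ * p s * ((1 + δ) * ω x - convol a ω x) :=
        mul_nonneg (mul_nonneg hdata.kappa_pos.le hp0) (sub_nonneg.2 h1)
      linarith
    · have h1 : p 0 = C := by simp [p]
      have h2 : q 0 = 1 := by simp [q]
      rw [h1, h2, hu.initial, one_smul, sub_nonneg]
      exact h0
  rw [sub_nonneg] at key
  rw [← Lp.coeFn_le] at key ⊢
  filter_upwards [key, Lp.coeFn_smul (p t) ω, Lp.coeFn_smul (q t) (u t),
    Lp.coeFn_smul (C * Real.exp ((κ * (1 + δ) - m) * t)) ω] with x h1 h2 h3 h4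
  rw [h2, h3] at h1
  rw [h4]
  simp only [Pi.smul_apply, smul_eq_mul] at *
  have hq0 : 0 < q t := Real.exp_pos _
  have hpq : C * Real.exp ((κ * (1 + δ) - m) * t) * q t = p t := by
    simp only [p, q]
    rw [mul_assoc, ← Real.exp_add]
    ring_nf
  refine le_of_mul_le_mul_left ?_ hq0
  rw [← hpq] at h1
  linarith

/-! ### Convolution estimates for sub-exponential densities -/

section Density

variable {a b : ℝ → ℝ}

theorem LongTailed.eventually_le (h : LongTailed b) {R δ : ℝ} (hR : 0 ≤ R) (hδ : 0 < δ) :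
    ∀ᶠ x in atTop, b (x - R) ≤ (1 + δ) * b x := by
  obtain ⟨⟨ρ, -, hpos⟩, hlim⟩ := h
  have h1 : Tendsto (fun x => (b (x - R + R) / b (x - R))⁻¹) atTop (𝓝 1⁻¹) :=
    ((hlim R hR).comp (tendsto_atTop_add_const_right atTop (-R) tendsto_id)).inv₀ one_ne_zero
  rw [inv_one] at h1
  filter_upwards [h1.eventually (gt_mem_nhds (show (1 : ℝ) < 1 + δ by linarith)),
    eventually_ge_atTop ρ] with x hx hxρ
  rw [sub_add_cancel, inv_div, div_lt_iff₀ (hpos x hxρ)] at hx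
  exact hx.le

theorem eventually_isEquivalent_le {f g : ℝ → ℝ} {c : ℝ} (hc : 0 ≤ c) (hg : ∀ x, 0 ≤ g x)
    (h : Asymptotics.IsEquivalent atTop f (fun x => c * g x)) {η : ℝ} (hη : 0 < η) :
    ∀ᶠ x in atTop, f x ≤ (c + η) * g x := by
  -- Dividing by `c + 1` rather than `c` covers `c = 0`.
  have h1 := h.isLittleO.def (show 0 < η / (c + 1) by positivity)
  filter_upwards [h1] with x hx
  simp only [Pi.sub_apply] at hx
  rw [Real.norm_eq_abs, Real.norm_eq_abs, abs_of_nonneg (mul_nonneg hc (hg x))] at hx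
  have h2 := (le_abs_self _).trans hx
  have h3 : η / (c + 1) * (c * g x) ≤ η * g x := by
    rw [← mul_assoc]
    refine mul_le_mul_of_nonneg_right ?_ (hg x)
    rw [div_mul_eq_mul_div, div_le_iff₀ (by positivity)]
    nlinarith
  linarith

/-- The full integral is at most `(2I + η/2) b(x)` with `I = ∫ b` over `[0, ∞)`. By symmetry both
end pieces are equal, and each is at least `b(x) ∫₀ᴿ b ≥ (I - η/4) b(x)` because `b` decreases; at
most `η b(x)` is left for the middle. -/
theorem eventually_middle_integral_le (hb0 : ∀ x, 0 ≤ b x) (hbdd : BddAbove (range b))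
    (hbi : Integrable b) (hS : SubexpDensity b) {ρ : ℝ} (hanti : AntitoneOn b (Ioi ρ))
    {η : ℝ} (hη : 0 < η) :
    ∀ᶠ R in atTop, ∀ᶠ x in atTop, ∫ z in R..x - R, b (x - z) * b z ≤ η * b x := by
  obtain ⟨-, -, -, hconv⟩ := hS
  obtain ⟨B, hB⟩ := hbdd
  have hBb : ∀ᵐ y, ‖b y‖ ≤ B := ae_of_all _ fun y => by
    rw [Real.norm_eq_abs, abs_of_nonneg (hb0 y)]
    exact hB (mem_range_self y)
  set I := ∫ y in Ici (0 : ℝ), b y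
  have hI : 0 ≤ I := integral_nonneg hb0
  have hlim : Tendsto (fun R => ∫ y in (0 : ℝ)..R, b y) atTop (𝓝 I) := by
    rw [show I = ∫ y in Ioi (0 : ℝ), b y from integral_Ici_eq_integral_Ioi]
    exact intervalIntegral_tendsto_integral_Ioi 0 hbi.integrableOn tendsto_id
  filter_upwards [hlim.eventually (lt_mem_nhds (show I - η / 4 < I by linarith)),
    eventually_ge_atTop 0] with R hR hR0
  filter_upwards [eventually_isEquivalent_le (by positivity) hb0 hconv (half_pos hη),
    eventually_gt_atTop (ρ + R)] with x hx hxR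
  have hint : ∀ c d, IntervalIntegrable (fun z => b (x - z) * b z) volume c d := fun c d =>
    (integrable_convol hbi hbi.aestronglyMeasurable hBb x).intervalIntegrable
  have hlow : b x * ∫ y in (0 : ℝ)..R, b y ≤ ∫ z in (0 : ℝ)..R, b (x - z) * b z := by
    rw [← intervalIntegral.integral_const_mul]
    refine intervalIntegral.integral_mono_on hR0 (hbi.intervalIntegrable.const_mul _) (hint _ _)
      fun z hz => mul_le_mul_of_nonneg_right (hanti ?_ ?_ ?_) (hb0 z)
    · simp only [mem_Ioi]; linarith [hz.2]
    · simp only [mem_Ioi]; linarith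
    · linarith [hz.1]
  have hsymm : ∫ z in x - R..x, b (x - z) * b z = ∫ z in (0 : ℝ)..R, b (x - z) * b z := by
    have := intervalIntegral.integral_comp_sub_left (a := 0) (b := R)
      (fun z => b (x - z) * b z) x
    rw [sub_zero] at this
    rw [← this]
    congr 1
    ext z
    rw [sub_sub_cancel, mul_comm]
  have hsplit := intervalIntegral.integral_add_adjacent_intervals (hint 0 R) (hint R (x - R))
  have hsplit' := intervalIntegral.integral_add_adjacent_intervals (hint 0 (x - R)) (hint (x - R) x)
  have h4 := mul_le_mul_of_nonneg_left hR.le (hb0 x)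
  nlinarith

theorem eventually_setIntegral_Iio_neg_le (hb0 : ∀ x, 0 ≤ b x) (hbi : Integrable b) {η : ℝ}
    (hη : 0 < η) : ∀ᶠ R in atTop, ∫ y in Iio (-R), b y ≤ η := by
  have hlim := intervalIntegral_tendsto_integral hbi tendsto_neg_atTop_atBot tendsto_id
  filter_upwards [hlim.eventually (lt_mem_nhds (show (∫ y, b y) - η < ∫ y, b y by linarith)),
    eventually_ge_atTop 0] with R hR hR0
  have hR' : -R ≤ R := by linarith
  simp only [id_eq] at hR
  rw [intervalIntegral.integral_of_le hR'] at hR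
  have h1 : ∫ y in Iio (-R) ∪ Ioc (-R) R, b y ≤ ∫ y, b y :=
    setIntegral_le_integral hbi (ae_of_all _ hb0)
  have hdisj : Disjoint (Iio (-R)) (Ioc (-R) R) := disjoint_left.2 fun y h1 h2 => lt_asymm h1 h2.1
  rw [setIntegral_union hdisj measurableSet_Ioc
    hbi.integrableOn hbi.integrableOn] at h1
  linarith

theorem convol_eq_integral_mul_sub (a f : ℝ → ℝ) (x : ℝ) :
    convol a f x = ∫ z, a z * f (x - z) := by
  unfold convol
  rw [← integral_sub_left_eq_self (fun z => a z * f (x - z)) volume x]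
  congr 1
  ext y
  rw [sub_sub_cancel]

/-- If the kernel is dominated by a sub-exponential density `b` on the right, then convolution
with it asymptotically does not increase small functions dominated by `b`. -/
theorem exists_convol_le_of_subexpDensity (ha : Integrable a) (ha0 : ∀ᵐ x, 0 ≤ a x)
    (ha1 : ∫ x, a x = 1) (hb0 : ∀ x, 0 ≤ b x) (hbdd : BddAbove (range b)) (hbi : Integrable b)
    (hS : SubexpDensity b) (hd : TailDecreasing b) {ρ : ℝ} (hab : ∀ᵐ x, ρ < x → a x ≤ b x)
    {δ : ℝ} (hδ : 0 < δ) :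
    ∃ lam N : ℝ, 0 < lam ∧ ∀ ω : ℝ → ℝ, AEStronglyMeasurable ω volume → (∀ y, 0 ≤ ω y) →
      (∀ y, ω y ≤ lam) → (∀ y, ρ < |y| → ω y ≤ b y) →
      ∀ x, N ≤ x → convol a ω x ≤ (1 + δ) * b x := by
  obtain ⟨⟨ρ₁, -, -, hanti⟩, -⟩ := hd
  have hanti := hanti.antitoneOn
  set η := min (δ / 4) 1
  have hη : 0 < η := lt_min (by linarith) one_pos
  have hη1 : η ≤ 1 := min_le_right _ _
  have hη4 : 4 * η ≤ δ := by linarith [min_le_left (δ / 4) 1]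
  obtain ⟨R, hmid, hleft, hR0, hRρ, hRρ₁⟩ :=
    ((eventually_middle_integral_le hb0 hbdd hbi hS hanti hη).and
      ((eventually_setIntegral_Iio_neg_le hb0 hbi hη).and
        ((eventually_gt_atTop 0).and ((eventually_gt_atTop ρ).and
          (eventually_gt_atTop ρ₁))))).exists
  obtain ⟨N, hN⟩ := eventually_atTop.1 (hmid.and ((hS.2.2.1.eventually_le hR0.le hη).and
    (eventually_gt_atTop (R + R))))
  -- `lam` and `N` are fixed before `ω`, which may therefore be built from them. The value `η /
  -- (4R)` offsets the length `2R` and the bound `a ≤ 2 b(x)` on the window around `x`.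
  refine ⟨η / (4 * R), N, by positivity, fun ω hωm hω0 hωlam hωb x hx => ?_⟩
  obtain ⟨hmid, hlong, hxR⟩ := hN x hx
  obtain ⟨B, hB⟩ := hbdd
  have hBb : ∀ᵐ y, ‖b y‖ ≤ B := ae_of_all _ fun y => by
    rw [Real.norm_eq_abs, abs_of_nonneg (hb0 y)]
    exact hB (mem_range_self y)
  -- Majorants of `a(z) ω(x - z)` for `z ≤ R` (long tail of `b`), `R < z ≤ x - R` (both factors at
  -- most `b`), `x - R < z ≤ x + R` (`ω ≤ lam`) and `z > x + R` (`a(z) ≤ b(x)`, small mass of `b` on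
  -- the far left). Their integrals add up to at most `(1 + 4η) b(x)`.
  set H₁ : ℝ → ℝ := fun z => (1 + η) * b x * a z
  set H₂ : ℝ → ℝ := (Ioc R (x - R)).indicator fun z => b (x - z) * b z
  set H₃ : ℝ → ℝ := (Icc (x - R) (x + R)).indicator fun _ => 2 * b x * (η / (4 * R))
  set H₄ : ℝ → ℝ := fun z => b x * (Iio (-R)).indicator b (x - z)
  have hi₁ : Integrable H₁ := ha.const_mul _
  have hi₂ : Integrable H₂ :=
    (integrable_convol hbi hbi.aestronglyMeasurable hBb x).indicator measurableSet_Ioc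
  have hi₃ : Integrable H₃ := 
    (integrable_indicator_iff measurableSet_Icc).2 (integrableOn_const (by simp))
  have hi₄ : Integrable H₄ := ((hbi.indicator measurableSet_Iio).comp_sub_left x).const_mul _
  have e₁ : ∫ z, H₁ z = (1 + η) * b x := by
    simp only [H₁]
    rw [integral_const_mul, ha1, mul_one]
  have e₂ : ∫ z, H₂ z ≤ η * b x := by
    rw [integral_indicator measurableSet_Ioc, ← intervalIntegral.integral_of_le (by linarith)]
    exact hmid
  have e₃ : ∫ z, H₃ z = η * b x := by
    rw [integral_indicator measurableSet_Icc, setIntegral_const, Real.volume_real_Icc_of_le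
      (by linarith), smul_eq_mul]
    field_simp
    ring
  have e₄ : ∫ z, H₄ z ≤ η * b x := by
    simp only [H₄]
    rw [integral_const_mul, integral_sub_left_eq_self (fun y => (Iio (-R)).indicator b y) volume x,
      integral_indicator measurableSet_Iio, mul_comm]
    exact mul_le_mul_of_nonneg_right hleft (hb0 x)
  have n₂ : ∀ z, 0 ≤ H₂ z := fun z =>
    indicator_nonneg (fun y _ => mul_nonneg (hb0 _) (hb0 _)) z
  have n₃ : ∀ z, 0 ≤ H₃ z := fun z =>
    indicator_nonneg (fun y _ => by have := hb0 x; positivity) z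
  have n₄ : ∀ z, 0 ≤ H₄ z := fun z =>
    mul_nonneg (hb0 x) (indicator_nonneg (fun y _ => hb0 y) _)
  have hle : ∀ᵐ z, a z * ω (x - z) ≤ H₁ z + H₂ z + H₃ z + H₄ z := by
    filter_upwards [ha0, hab] with z hz0 hzb
    have n₁ : 0 ≤ H₁ z := mul_nonneg (mul_nonneg (by linarith) (hb0 x)) hz0
    have m₂ := n₂ z
    have m₃ := n₃ z
    have m₄ := n₄ z
    rcases le_or_gt z R with h1 | h1
    · have h2 : ω (x - z) ≤ (1 + η) * b x := by
        refine (hωb _ ?_).trans ((hanti ?_ ?_ ?_).trans hlong)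
        · exact lt_of_lt_of_le (by linarith) (le_abs_self (x - z))
        · simp only [mem_Ioi]; linarith
        · simp only [mem_Ioi]; linarith
        · linarith
      have h3 := mul_le_mul_of_nonneg_left h2 hz0
      have h4 : H₁ z = (1 + η) * b x * a z := rfl
      linarith
    have hzb := hzb (by linarith)
    rcases le_or_gt z (x - R) with h2 | h2
    · have h3 : H₂ z = b (x - z) * b z := indicator_of_mem (show z ∈ Ioc R (x - R) from ⟨h1, h2⟩) _
      have h4 : ω (x - z) ≤ b (x - z) :=
        hωb _ (lt_of_lt_of_le (by linarith) (le_abs_self (x - z)))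
      have h5 := mul_le_mul hzb h4 (hω0 _) (hb0 _)
      linarith
    rcases le_or_gt z (x + R) with h3 | h3
    · have h4 : H₃ z = 2 * b x * (η / (4 * R)) :=
        indicator_of_mem (show z ∈ Icc (x - R) (x + R) from ⟨h2.le, h3⟩) _
      have h5 : a z ≤ 2 * b x := by
        refine hzb.trans ((hanti ?_ ?_ h2.le).trans (hlong.trans ?_))
        · simp only [mem_Ioi]; linarith
        · simp only [mem_Ioi]; linarith
        · exact mul_le_mul_of_nonneg_right (by linarith) (hb0 x)
      have h6 := mul_le_mul h5 (hωlam (x - z)) (hω0 _) (by linarith [hb0 x])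
      linarith
    · have h4 : H₄ z = b x * b (x - z) := by
        simp only [H₄]
        rw [indicator_of_mem (show x - z ∈ Iio (-R) by simp only [mem_Iio]; linarith)]
      have h5 : a z ≤ b x := hzb.trans (hanti (by simp only [mem_Ioi]; linarith)
        (by simp only [mem_Ioi]; linarith) (by linarith))
      have h6 : ω (x - z) ≤ b (x - z) :=
        hωb _ (lt_of_lt_of_le (by linarith) (neg_le_abs (x - z)))
      have h7 := mul_le_mul h5 h6 (hω0 _) (hb0 _)
      linarith
  have hi : Integrable fun z => a z * ω (x - z) :=
    ha.mul_bdd (c := η / (4 * R))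
      (hωm.comp_quasiMeasurePreserving (quasiMeasurePreserving_sub_left volume x))
      (ae_of_all _ fun z => by
        rw [Real.norm_eq_abs, abs_of_nonneg (hω0 _)]
        exact hωlam _)
  rw [convol_eq_integral_mul_sub]
  have hfin := integral_mono_ae hi (((hi₁.add hi₂).add hi₃).add hi₄) hle
  rw [integral_add' ((hi₁.add hi₂).add hi₃) hi₄, integral_add' (hi₁.add hi₂) hi₃,
    integral_add' hi₁ hi₂] at hfin
  have := mul_le_mul_of_nonneg_right hη4 (hb0 x)
  linarith

end Density

/-! ### Tails of convolutions of measures on the half-line -/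

section HalfLine

variable {ν : Measure ℝ} [IsFiniteMeasure ν]

theorem conv_real_Ioi (ν : Measure ℝ) [IsFiniteMeasure ν] (x : ℝ) :
    (ν.conv ν).real (Ioi x) = (ν.prod ν).real {p | x < p.1 + p.2} := by
  rw [measureReal_def, Measure.conv, Measure.map_apply (by fun_prop) measurableSet_Ioi]
  rfl

theorem measureReal_Ici_zero (h0 : ν (Iio 0) = 0) : ν.real (Ici 0) = ν.real univ := by
  have := measureReal_compl (μ := ν) (measurableSet_Iio (a := (0 : ℝ)))
  rwa [compl_Iio, measureReal_def (s := Iio 0), h0, ENNReal.toReal_zero, sub_zero] at this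

theorem measureReal_Icc_zero (h0 : ν (Iio 0) = 0) {R : ℝ} (hR : 0 ≤ R) :
    ν.real (Icc 0 R) = ν.real univ - ν.real (Ioi R) := by
  have hdisj : Disjoint (Icc 0 R) (Ioi R) := disjoint_left.2 fun y h1 h2 => not_lt.2 h1.2 h2
  have := measureReal_union (μ := ν) hdisj measurableSet_Ioi
  rw [Icc_union_Ioi_eq_Ici hR, measureReal_Ici_zero h0] at this
  linarith

theorem measureReal_Ioc_eq {R x : ℝ} (hRx : R ≤ x) :
    ν.real (Ioc R x) = ν.real (Ioi R) - ν.real (Ioi x) := by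
  have hdisj : Disjoint (Ioc R x) (Ioi x) := disjoint_left.2 fun y h1 h2 => not_lt.2 h1.2 h2
  have := measureReal_union (μ := ν) hdisj measurableSet_Ioi
  rw [Ioc_union_Ioi_eq_Ioi hRx] at this
  linarith

/-- The left side is the mass of three disjoint rectangles inside `{s + t > x}`. The last one brings
in the tail at `x - R`, so an upper bound for the convolution tail yields a long-tail estimate. -/
theorem tail_shift_le_conv (h0 : ν (Iio 0) = 0) {R x : ℝ} (hR : 0 ≤ R) (hRx : R < x) :
    ν.real univ * ν.real (Ioi x) + ν.real (Ioi x) * (ν.real univ - ν.real (Ioi R)) +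
      ν.real (Ioi (x - R)) * (ν.real (Ioi R) - ν.real (Ioi x)) ≤ (ν.conv ν).real (Ioi x) := by
  rw [conv_real_Ioi, ← measureReal_Icc_zero h0 hR, ← measureReal_Ioc_eq hRx.le,
    ← measureReal_Ici_zero h0, ← measureReal_prod_prod, ← measureReal_prod_prod,
    ← measureReal_prod_prod, ← measureReal_union, ← measureReal_union]
  · refine measureReal_mono ?_
    rintro ⟨s, t⟩ ((⟨h1, h2⟩ | ⟨h1, h2⟩) | ⟨h1, h2⟩) <;>
      simp only [mem_Ici, mem_Ioi, mem_Icc, mem_Ioc, mem_ofPred_eq] at *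
    · linarith
    · linarith [h2.1]
    · linarith [h2.1]
  · refine disjoint_left.2 ?_
    rintro ⟨s, t⟩ (⟨h1, h2⟩ | ⟨h1, h2⟩) ⟨h3, h4⟩
    · exact not_lt.2 h4.2 h2
    · exact not_lt.2 h2.2 h4.1
  · exact measurableSet_Ioi.prod measurableSet_Ioc
  · refine disjoint_left.2 ?_
    rintro ⟨s, t⟩ ⟨h1, h2⟩ ⟨h3, h4⟩
    exact not_lt.2 (h4.2.trans hRx.le) h2
  · exact measurableSet_Ioi.prod measurableSet_Icc

/-- The two strips where one variable is at most `R` and the other exceeds `x` already carry almost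
all of a sub-exponential convolution tail, so the region where both exceed `R` is small. -/
theorem middle_le_conv (h0 : ν (Iio 0) = 0) {R x : ℝ} (hR : 0 ≤ R) (hRx : R < x) :
    (ν.prod ν).real {p | R < p.1 ∧ R < p.2 ∧ x < p.1 + p.2} +
      2 * ((ν.real univ - ν.real (Ioi R)) * ν.real (Ioi x)) ≤ (ν.conv ν).real (Ioi x) := by
  rw [conv_real_Ioi, two_mul]
  nth_rewrite 2 [mul_comm]
  rw [← measureReal_Icc_zero h0 hR, ← measureReal_prod_prod, ← measureReal_prod_prod,
    ← measureReal_union, ← measureReal_union]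
  · refine measureReal_mono ?_
    rintro ⟨s, t⟩ (⟨h1, h2, h3⟩ | ⟨h1, h2⟩ | ⟨h1, h2⟩) <;>
      simp only [mem_Ioi, mem_Icc, mem_ofPred_eq] at *
    · exact h3
    · linarith [h1.1]
    · linarith [h2.1]
  · refine disjoint_left.2 ?_
    rintro ⟨s, t⟩ ⟨h1, h2, h3⟩ (⟨h4, h5⟩ | ⟨h4, h5⟩)
    · exact not_lt.2 h4.2 h1
    · exact not_lt.2 h5.2 h2
  · exact (measurableSet_Icc.prod measurableSet_Ioi).union
      (measurableSet_Ioi.prod measurableSet_Icc)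
  · refine disjoint_left.2 ?_
    rintro ⟨s, t⟩ ⟨h1, h2⟩ ⟨h3, h4⟩
    exact not_lt.2 (h1.2.trans hRx.le) h3
  · exact measurableSet_Ioi.prod measurableSet_Icc

theorem measurableSet_middle (R x : ℝ) :
    MeasurableSet {p : ℝ × ℝ | R < p.1 ∧ R < p.2 ∧ x < p.1 + p.2} :=
  (measurableSet_lt measurable_const measurable_fst).inter
    ((measurableSet_lt measurable_const measurable_snd).inter
      (measurableSet_lt measurable_const (measurable_fst.add measurable_snd)))

/-- Stochastic domination: each nonempty section in the first variable is a half-line starting at or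
beyond `R`. -/
theorem prod_middle_mono {μ : Measure ℝ} [IsFiniteMeasure μ] {R x : ℝ}
    (h : ∀ y, R ≤ y → μ (Ioi y) ≤ ν (Ioi y)) :
    (μ.prod ν) {p | R < p.1 ∧ R < p.2 ∧ x < p.1 + p.2} ≤
      (ν.prod ν) {p | R < p.1 ∧ R < p.2 ∧ x < p.1 + p.2} := by
  rw [Measure.prod_apply_symm (measurableSet_middle R x),
    Measure.prod_apply_symm (measurableSet_middle R x)]
  refine lintegral_mono fun s => ?_
  by_cases hs : R < s
  · have : (fun z => (z, s)) ⁻¹' {p : ℝ × ℝ | R < p.1 ∧ R < p.2 ∧ x < p.1 + p.2} =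
        Ioi (max R (x - s)) := by
      ext z
      simp only [mem_preimage, mem_ofPred_eq, mem_Ioi, max_lt_iff, hs, true_and,
        sub_lt_iff_lt_add]
    simp only [this]
    exact h _ (le_max_left _ _)
  · have : (fun z => (z, s)) ⁻¹' {p : ℝ × ℝ | R < p.1 ∧ R < p.2 ∧ x < p.1 + p.2} = ∅ := by
      ext z
      simp [hs]
    simp [this]

/-- With `μ = a dz`, the integral is a `μ × ν` mass inside the region where both variables exceed
`R`. Only tails of `a` are compared with `ν`, so no pointwise bound on `a` is needed. -/
theorem setIntegral_mul_tail_le {a : ℝ → ℝ} (ha : Integrable a) (ha0 : ∀ᵐ x, 0 ≤ a x)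
    {R N x : ℝ} (hRN : R ≤ N)
    (h : ∀ y, R ≤ y → ENNReal.ofReal (∫ z in Ioi y, a z) ≤ ν (Ioi y)) :
    ∫ z in Ioi R, a z * ν.real (Ioi (max (x - z) N)) ≤
      (ν.prod ν).real {p | R < p.1 ∧ R < p.2 ∧ x < p.1 + p.2} := by
  set μ : Measure ℝ := volume.withDensity fun z => ENNReal.ofReal (a z)
  have : IsFiniteMeasure μ := isFiniteMeasure_withDensity_ofReal ha.2
  have hμ : ∀ y, R ≤ y → μ (Ioi y) ≤ ν (Ioi y) := fun y hy => by
    rw [withDensity_apply _ measurableSet_Ioi,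
      ← ofReal_integral_eq_lintegral_ofReal ha.integrableOn (ae_restrict_of_ae ha0)]
    exact h y hy
  have hprod := prod_middle_mono (x := x) hμ
  have ham : AEMeasurable (fun z => ENNReal.ofReal (a z)) := ha.1.aemeasurable.ennreal_ofReal
  rw [Measure.prod_apply (measurableSet_middle R x), lintegral_withDensity_eq_lintegral_mul₀ ham
    (measurable_measure_prodMk_left (measurableSet_middle R x)).aemeasurable] at hprod
  by_cases hint : IntegrableOn (fun z => a z * ν.real (Ioi (max (x - z) N))) (Ioi R)
  · rw [integral_eq_lintegral_of_nonneg_ae ?_ hint.1]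
    · refine ENNReal.toReal_mono (measure_ne_top _ _) (le_trans ?_ hprod)
      refine le_trans (setLIntegral_mono_ae' (g := (fun z => ENNReal.ofReal (a z)) *
        fun z => ν (Prod.mk z ⁻¹' {p : ℝ × ℝ | R < p.1 ∧ R < p.2 ∧ x < p.1 + p.2}))
        measurableSet_Ioi ?_) (setLIntegral_le_lintegral _ _)
      filter_upwards [ha0] with z hz hzR
      rw [ENNReal.ofReal_mul hz, Pi.mul_apply, ofReal_measureReal]
      gcongr
      intro s hs
      rw [mem_Ioi, max_lt_iff] at hs
      exact ⟨hzR, hRN.trans_lt hs.2, by linarith [hs.1]⟩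
    · refine ae_restrict_of_ae ?_
      filter_upwards [ha0] with z hz using mul_nonneg hz measureReal_nonneg
  · rw [integral_undef hint]
    exact measureReal_nonneg

end HalfLine

/-! ### Convolution estimates for sub-exponential distributions -/

section Distribution

variable {a b : ℝ → ℝ}

theorem isFiniteMeasure_halfLineMeasure (hb : Antitone b) (hb0 : ∀ x, 0 ≤ b x)
    (hbdd : BddAbove (range b)) : IsFiniteMeasure (halfLineMeasure b hb) := by
  obtain ⟨B, hB⟩ := hbdd
  have hB : ∀ y, b y ≤ B := fun y => hB (mem_range_self y)
  have : IsFiniteMeasure hb.neg.stieltjesFunction.measure := by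
    refine StieltjesFunction.isFiniteMeasure_of_forall_abs_le _ (C := B) fun x => ?_
    rw [Monotone.stieltjesFunction_eq, abs_le]
    constructor
    · exact le_trans (neg_le_neg (hB x)) (hb.neg.le_rightLim le_rfl)
    · refine (hb.neg.rightLim_le (lt_add_one x)).trans ?_
      have := hb0 (x + 1)
      have := hb0 x
      have := hB x
      linarith
  unfold halfLineMeasure
  infer_instance

theorem halfLineMeasure_Iio_zero (hb : Antitone b) : halfLineMeasure b hb (Iio 0) = 0 := by
  rw [halfLineMeasure, Measure.map_apply (by fun_prop) measurableSet_Iio]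
  have : (fun y : ℝ => max y 0) ⁻¹' Iio 0 = ∅ := by
    ext y
    simp
  rw [this, measure_empty]

theorem tendsto_rightLim_neg (hb : Antitone b) {l : ℝ} {F : Filter ℝ} (hF : Tendsto b F (𝓝 l))
    (hF' : Tendsto b (map (fun x => x + 1) F) (𝓝 l)) :
    Tendsto hb.neg.stieltjesFunction F (𝓝 (-l)) := by
  refine tendsto_of_tendsto_of_tendsto_of_le_of_le hF.neg (tendsto_map'_iff.1 hF').neg
    (fun x => ?_) (fun x => ?_)
  · exact hb.neg.le_rightLim le_rfl
  · exact hb.neg.rightLim_le (lt_add_one x)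

theorem halfLineMeasure_Ioi (hb : Antitone b) (hlim : Tendsto b atTop (𝓝 0)) {x : ℝ} (hx : 0 ≤ x)
    (hc : ContinuousAt b x) : halfLineMeasure b hb (Ioi x) = ENNReal.ofReal (b x) := by
  have hpre : (fun y : ℝ => max y 0) ⁻¹' Ioi x = Ioi x := by
    ext y
    simp [not_lt.2 hx]
  have hl := tendsto_rightLim_neg hb hlim (hlim.comp (tendsto_atTop_add_const_right _ 1 tendsto_id))
  have hr : Function.rightLim (fun x => -b x) x = -b x := hc.neg.continuousWithinAt.rightLim_eq
  rw [halfLineMeasure, Measure.map_apply (by fun_prop) measurableSet_Ioi, hpre,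
    StieltjesFunction.measure_Ioi _ hl, Monotone.stieltjesFunction_eq, hr]
  simp

theorem halfLineMeasure_univ (hb : Antitone b) (hlim : Tendsto b atTop (𝓝 0))
    (hbdd : BddAbove (range b)) :
    halfLineMeasure b hb univ = ENNReal.ofReal (⨆ y, b y) := by
  have hl := tendsto_rightLim_neg hb hlim (hlim.comp (tendsto_atTop_add_const_right _ 1 tendsto_id))
  have hbot := tendsto_atBot_ciSup hb hbdd
  have hl' := tendsto_rightLim_neg hb hbot
    (hbot.comp (tendsto_atBot_add_const_right _ 1 tendsto_id))
  rw [halfLineMeasure, Measure.map_apply (by fun_prop) MeasurableSet.univ, preimage_univ,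
    StieltjesFunction.measure_univ _ hl' hl]
  simp

/-- A strict failure at `y` would persist on an interval to the left of `y`, since the tail of `a`
is nonincreasing and `b` is continuous at `y`. -/
theorem tail_le_of_ae (ha : Integrable a) (ha0 : ∀ᵐ x, 0 ≤ a x) {ρ : ℝ}
    (h : ∀ᵐ x, ρ < x → ∫ z in Ioi x, a z ≤ b x) {y : ℝ} (hy : ρ < y) (hc : ContinuousAt b y) :
    ∫ z in Ioi y, a z ≤ b y := by
  by_contra! hlt
  obtain ⟨c, hcy, hc'⟩ := exists_Ioc_subset_of_mem_nhds
    (inter_mem (hc.eventually (gt_mem_nhds hlt)) (lt_mem_nhds hy)) ⟨ρ, hy⟩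
  have hnull : volume (Ioo c y) = 0 := by
    refine measure_mono_null (fun z hz => ?_) (ae_iff.1 h)
    obtain ⟨h1, h2⟩ := hc' ⟨hz.1, hz.2.le⟩
    have h3 : ∫ w in Ioi y, a w ≤ ∫ w in Ioi z, a w :=
      setIntegral_mono_set ha.integrableOn (ae_restrict_of_ae ha0)
        (Ioi_subset_Ioi hz.2.le).eventuallyLE
    simp only [mem_ofPred_eq, Classical.not_imp, not_le] at h1 h2 ⊢
    exact ⟨h2, by linarith⟩
  simp only [Real.volume_Ioo, ENNReal.ofReal_eq_zero] at hnull
  linarith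

/-- If the tail of the kernel is dominated by a sub-exponential tail `b`, then convolution with it
asymptotically does not increase truncations of `b`. -/
theorem exists_convol_le_of_classMS (ha : Integrable a) (ha0 : ∀ᵐ x, 0 ≤ a x)
    (ha1 : ∫ x, a x = 1) (hb0 : ∀ x, 0 ≤ b x) (hb : ClassMS b) {ρ : ℝ}
    (hab : ∀ᵐ x, ρ < x → ∫ z in Ioi x, a z ≤ b x) {δ : ℝ} (hδ : 0 < δ) :
    ∃ N₀ : ℝ, ∀ N, N₀ ≤ N → ∀ x, N ≤ x →
      convol a (fun y => b (max y N)) x ≤ (1 + δ) * b x := by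
  obtain ⟨hbdd, hanti, hlim, ⟨-, -, _, hconv⟩, ⟨⟨ρ₁, hρ₁, hpos, -⟩, -⟩, ρ₂, hρ₂, -, hcont⟩ := hb
  have hcont : ∀ x, ρ₂ < x → ContinuousAt b x := fun x hx =>
    hcont.continuousAt (Ioi_mem_nhds hx)
  set ν := halfLineMeasure b hanti
  have : IsFiniteMeasure ν := isFiniteMeasure_halfLineMeasure hanti hb0 hbdd
  have hν0 : ν (Iio 0) = 0 := halfLineMeasure_Iio_zero hanti
  set M := ⨆ y, b y
  have hM0 : 0 ≤ M := Real.iSup_nonneg hb0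
  have hM : ν.real univ = M := by
    rw [measureReal_def, halfLineMeasure_univ hanti hlim hbdd, ENNReal.toReal_ofReal hM0]
  have hν : ∀ x, ρ₂ < x → ν (Ioi x) = ENNReal.ofReal (b x) := fun x hx =>
    halfLineMeasure_Ioi hanti hlim (hρ₂.trans hx.le) (hcont x hx)
  have hνr : ∀ x, ρ₂ < x → ν.real (Ioi x) = b x := fun x hx => by
    rw [measureReal_def, hν x hx, ENNReal.toReal_ofReal (hb0 x)]
  obtain ⟨R, hbR, hRρ, hRρ₁, hRρ₂⟩ := ((hlim.eventually (ge_mem_nhds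
    (show (0 : ℝ) < δ / 8 by linarith))).and ((eventually_gt_atTop ρ).and
      ((eventually_gt_atTop ρ₁).and (eventually_gt_atTop ρ₂)))).exists
  have hR0 : 0 ≤ R := hρ₁.trans hRρ₁.le
  have hbRpos : 0 < b R := hpos R hRρ₁
  -- The long-tail property is derived from sub-exponentiality; `c` solves `(1 + c) / (1 - c) = 1 +
  -- δ / 2`.
  have hlong : ∀ᶠ x in atTop, b (x - R) ≤ (1 + δ / 2) * b x := by
    set c := δ / 2 / (2 + δ / 2)
    have hc : 0 < c := by positivity
    have hc1 : (1 + c) = (1 - c) * (1 + δ / 2) := by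
      simp only [c]
      field_simp
      ring
    have hc2 : c < 1 := by
      simp only [c]
      rw [div_lt_one (by positivity)]
      linarith
    filter_upwards [eventually_isEquivalent_le (by positivity) hb0 hconv (mul_pos hc hbRpos),
      hlim.eventually (ge_mem_nhds (mul_pos hc hbRpos)), eventually_gt_atTop (R + R)]
      with x h1 h2 h3
    have h4 := tail_shift_le_conv hν0 hR0 (show R < x by linarith)
    rw [hM, hνr x (by linarith), hνr R hRρ₂, hνr (x - R) (by linarith)] at h4
    have h5 : b (x - R) * ((1 - c) * b R) ≤ b (x - R) * (b R - b x) :=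
      mul_le_mul_of_nonneg_left (by linarith) (hb0 _)
    have h6 : ((1 - c) * b R) * b (x - R) ≤ ((1 - c) * b R) * ((1 + δ / 2) * b x) := by
      have : ((1 - c) * b R) * ((1 + δ / 2) * b x) = (1 + c) * (b R * b x) := by
        rw [hc1]
        ring
      linarith
    exact le_of_mul_le_mul_left h6 (mul_pos (by linarith) hbRpos)
  obtain ⟨N₁, hN₁⟩ := eventually_atTop.1 (hlong.and (eventually_isEquivalent_le (by positivity)
    hb0 hconv (show 0 < δ / 4 by linarith)))
  refine ⟨max N₁ (R + 1), fun N hN x hx => ?_⟩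
  have hRN : R < N := by linarith [le_max_right N₁ (R + 1)]
  obtain ⟨hlongx, hconvx⟩ := hN₁ x ((le_max_left _ _).trans (hN.trans hx))
  have hle : ∀ y, b (max y N) ≤ b N := fun y => hanti (le_max_right _ _)
  have hmeas : Measurable fun y => b (max y N) := hanti.measurable.comp (by fun_prop)
  have hi : Integrable fun z => a z * b (max (x - z) N) :=
    ha.mul_bdd (c := b N) (hmeas.comp (by fun_prop)).aestronglyMeasurable
      (ae_of_all _ fun z => by
        rw [Real.norm_eq_abs, abs_of_nonneg (hb0 _)]
        exact hle _)
  -- The convolution tail is at most `(2M + δ/4) b(x)` and the strips take `2 (M - b(R)) b(x)`; with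
  -- `b(R) ≤ δ/8` this leaves `δ/2`.
  have hmid : ∫ z in Ioi R, a z * b (max (x - z) N) ≤ (δ / 2) * b x := by
    have h1 := setIntegral_mul_tail_le (ν := ν) (x := x) ha ha0 hRN.le fun y hy => by
      rw [hν y (by linarith)]
      exact ENNReal.ofReal_le_ofReal
        (tail_le_of_ae ha ha0 hab (by linarith) (hcont y (by linarith)))
    have h2 := middle_le_conv hν0 hR0 (show R < x by linarith)
    rw [hM, hνr x (by linarith), hνr R hRρ₂] at h2
    have h3 : ∫ z in Ioi R, a z * b (max (x - z) N) =
        ∫ z in Ioi R, a z * ν.real (Ioi (max (x - z) N)) := by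
      congr 1
      ext z
      rw [hνr]
      exact lt_of_lt_of_le (by linarith) (le_max_right _ _)
    rw [h3]
    have h4 := mul_le_mul_of_nonneg_right hbR (hb0 x)
    linarith
  have hleft : ∫ z in Iic R, a z * b (max (x - z) N) ≤ (1 + δ / 2) * b x := by
    have h1 : ∫ z in Iic R, a z * b (max (x - z) N) ≤ ∫ z in Iic R, a z * ((1 + δ / 2) * b x) := by
      refine setIntegral_mono_on_ae hi.integrableOn (ha.mul_const _).integrableOn
        measurableSet_Iic ?_
      filter_upwards [ha0] with z hz hzR
      refine mul_le_mul_of_nonneg_left (le_trans (hanti ?_) hlongx) hz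
      exact le_trans (by linarith [mem_Iic.1 hzR]) (le_max_left _ _)
    have h2 : ∫ z in Iic R, a z ≤ 1 := ha1 ▸ setIntegral_le_integral ha ha0
    rw [integral_mul_const] at h1
    have h3 := mul_le_mul_of_nonneg_right h2
      (show 0 ≤ (1 + δ / 2) * b x from mul_nonneg (by linarith) (hb0 x))
    linarith
  rw [convol_eq_integral_mul_sub, ← intervalIntegral.integral_Iic_add_Ioi (b := R)
    hi.integrableOn hi.integrableOn]
  linarith

end Distribution

/-! ### Extinction ahead of the front -/

section Front

variable {κ m θ : ℝ} {a : ℝ → ℝ} {G : E → E} {u₀ : E} {u : ℝ → E} {b : ℝ → ℝ}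

theorem rightFront_lt_imp {β : ℝ} (hβ : 0 < β) (hd : TailDecreasing b) (hc : TailContinuous b)
    {ε : ℝ} (hε : 0 < ε) (M : ℝ) :
    ∀ᶠ t in atTop, ∀ x, rightFront β b (t + ε * t) < x →
      M < x ∧ b x ≤ Real.exp (-(β * (t + ε * t))) := by
  obtain ⟨ρ, hρ, -, hanti⟩ := hd.1
  have ht : Tendsto (fun t : ℝ => t + ε * t) atTop atTop :=
    tendsto_id.atTop_add_atTop (tendsto_id.const_mul_atTop hε)
  filter_upwards [ht.eventually (isGreatest_rightFront hβ hd hc (max M ρ))] with t ht x hx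
  obtain ⟨h1, h2, -⟩ := ht
  rw [max_lt_iff] at h1
  refine ⟨h1.1.trans hx, ?_⟩
  rw [← show b _ = _ from h2]
  exact (hanti (mem_Ioi.2 h1.2) (mem_Ioi.2 (h1.2.trans hx)) hx).le

/-- A solution vanishes asymptotically where a supersolution profile `ω` is below
`exp (-β (t + ε t))`. -/
theorem tendsto_essSup_of_profile (hdata : Data κ m a G) (hu : IsSolution κ m a G u₀ u)
    {ε C lam : ℝ} (hε : 0 < (κ - m) * ε) (hC : 0 ≤ C) {ω : ℝ → ℝ}
    (hωm : AEStronglyMeasurable ω volume) (hω0 : ∀ x, 0 ≤ ω x) (hωlam : ∀ x, ω x ≤ lam)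
    (hω : ∀ x, convol a ω x ≤ (1 + (κ - m) * ε / (2 * κ)) * ω x)
    (h0 : ∀ᵐ x, u₀ x ≤ C * ω x) {Λ : ℝ → Set ℝ} (hΛm : ∀ t, MeasurableSet (Λ t))
    (hΛ : ∀ᶠ t in atTop, ∀ x ∉ Λ t, ω x ≤ Real.exp (-((κ - m) * (t + ε * t)))) :
    Tendsto (fun t : ℝ => essSup (fun x => ‖u t x‖ₑ) (volume.restrict (Λ t)ᶜ)) atTop (𝓝 0) := by
  have hmem : MemLp ω ⊤ volume := memLp_top_of_bound hωm lam (ae_of_all _ fun x => by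
    rw [Real.norm_eq_abs, abs_of_nonneg (hω0 x)]
    exact hωlam x)
  set w : E := hmem.toLp ω
  have hw : ⇑w =ᵐ[volume] ω := hmem.coeFn_toLp
  have hκ := hdata.kappa_pos
  have hsuper : ∀ᵐ x, convol a w x ≤ (1 + (κ - m) * ε / (2 * κ)) * w x := by
    filter_upwards [hw] with x hx
    rw [convol_congr_ae hw, hx]
    exact hω x
  have hinit : u₀ ≤ C • w := by
    rw [← Lp.coeFn_le]
    filter_upwards [hw, h0, Lp.coeFn_smul C w] with x h1 h2 h3
    rw [h3, Pi.smul_apply, h1]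
    exact h2
  have hlim : Tendsto (fun t : ℝ => ENNReal.ofReal (C * Real.exp (-((κ - m) * ε / 2 * t)))) atTop
      (𝓝 0) := by
    have h1 : Tendsto (fun t : ℝ => Real.exp (-((κ - m) * ε / 2 * t))) atTop (𝓝 0) :=
      Real.tendsto_exp_neg_atTop_nhds_zero.comp
        (tendsto_id.const_mul_atTop (show 0 < (κ - m) * ε / 2 by linarith))
    simpa using ENNReal.tendsto_ofReal (h1.const_mul C)
  refine tendsto_of_tendsto_of_tendsto_of_le_of_le' tendsto_const_nhds hlim
    (Eventually.of_forall fun t => zero_le) ?_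
  filter_upwards [hΛ, eventually_ge_atTop 0] with t ht ht0
  refine essSup_le_of_ae_le _ ?_
  have hle := solution_le_of_convol_le hdata hu hC hsuper hinit ht0
  rw [← Lp.coeFn_le] at hle
  set K := C * Real.exp ((κ * (1 + (κ - m) * ε / (2 * κ)) - m) * t)
  refine (ae_restrict_iff' (hΛm t).compl).2 ?_
  filter_upwards [hle, hw, Lp.coeFn_smul K w, (Lp.coeFn_nonneg _).2 (hu.nonneg t ht0)]
    with x h1 h2 h3 h4 hx
  rw [h3, Pi.smul_apply, h2, smul_eq_mul] at h1
  rw [Real.enorm_eq_ofReal h4]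
  refine ENNReal.ofReal_le_ofReal (h1.trans ?_)
  refine (mul_le_mul_of_nonneg_left (ht x hx) (by positivity)).trans_eq ?_
  -- The exponents combine to `(β + βε/2) t - β (1 + ε) t = -(βε/2) t`.
  simp only [K]
  rw [mul_assoc, ← Real.exp_add]
  congr 2
  field_simp
  ring

theorem ae_le_of_le_constE {v : E} {c : ℝ} (h : v ≤ constE c) : ∀ᵐ x, v x ≤ c := by
  rw [← Lp.coeFn_le] at h
  filter_upwards [h, coeFn_constE c] with x h1 h2
  rwa [h2] at h1

theorem tendsto_essSup_of_classMS (hdata : Data κ m a G) (hgrowth : GrowthPos κ m)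
    (hθ : 0 < θ) (hu₀θ : u₀ ≤ constE θ) (hu : IsSolution κ m a G u₀ u) (hb0 : ∀ x, 0 ≤ b x)
    (hb : ClassMS b) {ρ : ℝ}
    (hmax : ∀ᵐ x, ρ < x → max (∫ y in Ioi x, a y) (u₀ x) ≤ b x) {ε : ℝ} (hε : 0 < ε) :
    Tendsto (fun t : ℝ => essSup (fun x => ‖u t x‖ₑ) (volume.restrict
      (Iic (rightFront (κ - m) b (t + ε * t)))ᶜ)) atTop (𝓝 0) := by
  have hκ := hdata.kappa_pos
  have hβ : 0 < κ - m := hgrowth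
  obtain ⟨N₀, hN₀⟩ := exists_convol_le_of_classMS hdata.a_integrable hdata.a_nonneg
    hdata.a_integral hb0 hb (hmax.mono fun x h hx => (le_max_left _ _).trans (h hx))
    (show 0 < (κ - m) * ε / (2 * κ) by positivity)
  obtain ⟨-, hanti, -, -, hd, hc⟩ := hb
  obtain ⟨ρ₁, -, hpos, -⟩ := hd.1
  obtain ⟨N, hNN₀, hNρ, hNρ₁⟩ := ((eventually_ge_atTop N₀).and
    ((eventually_gt_atTop ρ).and (eventually_gt_atTop ρ₁))).exists
  have hbN : 0 < b N := hpos N hNρ₁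
  have hmeas : Measurable fun y => b (max y N) := hanti.measurable.comp (by fun_prop)
  have hle : ∀ y, b (max y N) ≤ b N := fun y => hanti (le_max_right _ _)
  -- The profile is frozen at its maximum `b N` on `(-∞, N]`, where averaging cannot increase it.
  -- The constant `C` handles `u₀ ≤ θ` there and `u₀ ≤ b` beyond `N`.
  refine tendsto_essSup_of_profile hdata hu (mul_pos hβ hε) (C := max 1 (θ / b N)) (by positivity)
    (lam := b N) (ω := fun y => b (max y N)) hmeas.aestronglyMeasurable (fun _ => hb0 _) hle
    (fun x => ?_) ?_ (fun _ => measurableSet_Iic) ?_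
  · rcases le_total x N with hx | hx
    · rw [max_eq_right hx]
      have h1 : convol a (fun y => b (max y N)) x ≤ convol a (fun _ => b N) x :=
        convol_mono hdata.a_nonneg
          (integrable_convol hdata.a_integrable hmeas.aestronglyMeasurable (C := b N)
            (ae_of_all _ fun y => by
              rw [Real.norm_eq_abs, abs_of_nonneg (hb0 _)]
              exact hle y) x)
          ((hdata.a_integrable.comp_sub_left x).mul_const _) (ae_of_all _ hle)
      rw [convol_const, hdata.a_integral] at h1
      refine h1.trans (mul_le_mul_of_nonneg_right ?_ hbN.le)
      have : 0 < (κ - m) * ε / (2 * κ) := by positivity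
      linarith
    · rw [max_eq_left hx]
      exact hN₀ N hNN₀ x hx
  · filter_upwards [hmax, ae_le_of_le_constE hu₀θ] with x h1 h2
    rcases le_or_gt x N with hx | hx
    · rw [max_eq_right hx]
      calc u₀ x ≤ θ := h2
        _ = θ / b N * b N := by field_simp
        _ ≤ _ := mul_le_mul_of_nonneg_right (le_max_right _ _) hbN.le
    · rw [max_eq_left hx.le]
      exact ((le_max_right _ _).trans (h1 (hNρ.trans hx))).trans
        (le_mul_of_one_le_left (hb0 x) (le_max_left _ _))
  · filter_upwards [rightFront_lt_imp hβ hd hc hε N] with t ht x hx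
    obtain ⟨h1, h2⟩ := ht x (not_le.1 hx)
    rw [max_eq_left h1.le]
    exact h2

theorem integrable_of_classS (hb : ClassS b) : Integrable b := by
  have h1 : IntegrableOn b (Ici 0) := hb.1.2.1.1
  have h2 : IntegrableOn b (Iic 0) := by
    have h3 := (Measure.measurePreserving_neg (volume : Measure ℝ)).integrableOn_comp_preimage
      (MeasurableEquiv.neg ℝ).measurableEmbedding (f := b) (s := Iic 0)
    refine h3.1 ?_
    have h4 : Neg.neg ⁻¹' Iic (0 : ℝ) = Ici 0 := by
      ext y
      exact Left.neg_nonpos_iff (a := y)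
    rw [h4]
    exact hb.2.2.1.1
  have := h2.union h1
  rwa [Iic_union_Ici, integrableOn_univ] at this

theorem tendsto_essSup_of_classS (hdata : Data κ m a G) (hgrowth : GrowthPos κ m)
    (hθ : 0 < θ) (hu₀θ : u₀ ≤ constE θ) (hu : IsSolution κ m a G u₀ u) (hb0 : ∀ x, 0 ≤ b x)
    (hb : ClassS b) {ρ : ℝ}
    (hmax : ∀ᵐ x, ρ < |x| → max (a x) (u₀ x) ≤ b x) {ε : ℝ} (hε : 0 < ε) :
    Tendsto (fun t : ℝ => essSup (fun x => ‖u t x‖ₑ) (volume.restrict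
      (Icc (-leftFront (κ - m) b (t + ε * t)) (rightFront (κ - m) b (t + ε * t)))ᶜ))
      atTop (𝓝 0) := by
  have hκ := hdata.kappa_pos
  have hβ : 0 < κ - m := hgrowth
  have hδ : 0 < (κ - m) * ε / (2 * κ) := by positivity
  set δ := (κ - m) * ε / (2 * κ)
  have hbi := integrable_of_classS hb
  obtain ⟨⟨hbdd, hS, hd, hc⟩, hbdd', hS', hd', hc'⟩ := hb
  obtain ⟨ρ₁, -, hpos, hanti⟩ := hd.1
  obtain ⟨ρ₂, -, hpos', hanti'⟩ := hd'.1
  set r := max ρ (max ρ₁ ρ₂)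
  have hrρ : ρ ≤ r := le_max_left _ _
  have hrρ₁ : ρ₁ ≤ r := (le_max_left _ _).trans (le_max_right _ _)
  have hrρ₂ : ρ₂ ≤ r := (le_max_right _ _).trans (le_max_right _ _)
  have hneg : Measure.QuasiMeasurePreserving (fun x : ℝ => -x) volume volume :=
    (Measure.measurePreserving_neg (volume : Measure ℝ)).quasiMeasurePreserving
  obtain ⟨lam₁, N₁, hlam₁, hconv₁⟩ := exists_convol_le_of_subexpDensity (ρ := r)
    hdata.a_integrable hdata.a_nonneg hdata.a_integral hb0 hbdd hbi hS hd
    (hmax.mono fun x h hx => (le_max_left _ _).trans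
      (h (lt_of_lt_of_le (hrρ.trans_lt hx) (le_abs_self x)))) hδ
  -- The left tail is handled by reflecting `a` and `b`.
  obtain ⟨lam₂, N₂, hlam₂, hconv₂⟩ := exists_convol_le_of_subexpDensity (ρ := r)
    hdata.a_integrable.comp_neg (hneg.ae hdata.a_nonneg)
    ((integral_neg_eq_self a volume).trans hdata.a_integral) (fun x => hb0 (-x)) hbdd'
    hbi.comp_neg hS' hd'
    ((hneg.ae hmax).mono fun x h hx => (le_max_left _ _).trans
      (h (by rw [abs_neg]; exact lt_of_lt_of_le (hrρ.trans_lt hx) (le_abs_self x)))) hδ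
  obtain ⟨N, hN₁, hN₂, hNr⟩ := ((eventually_ge_atTop N₁).and
    ((eventually_ge_atTop N₂).and (eventually_gt_atTop r))).exists
  have hbN : 0 < b N := hpos N (hrρ₁.trans_lt hNr)
  have hbN' : 0 < b (-N) := hpos' N (hrρ₂.trans_lt hNr)
  -- The bounds by `b (±N)` ensure `ω ≤ b` also on `r < |y| ≤ N`, where `ω = lam`.
  obtain ⟨lam, hlam, hlamle₁, hlamle₂, hlamN, hlamN'⟩ : ∃ lam : ℝ, 0 < lam ∧ lam ≤ lam₁ ∧
      lam ≤ lam₂ ∧ lam ≤ b N ∧ lam ≤ b (-N) :=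
    ⟨min (min lam₁ lam₂) (min (b N) (b (-N))), by positivity,
      (min_le_left _ _).trans (min_le_left _ _), (min_le_left _ _).trans (min_le_right _ _),
      (min_le_right _ _).trans (min_le_left _ _), (min_le_right _ _).trans (min_le_right _ _)⟩
  -- The indicator keeps `ω = lam` on `[-N, N]`, where `b` may be small or vanish.
  set ω : ℝ → ℝ := fun y => min lam (b y + (Icc (-N) N).indicator (fun _ => lam) y)
  have hωm : AEStronglyMeasurable ω volume := by
    refine aestronglyMeasurable_const.inf (hbi.1.add ?_)
    exact aestronglyMeasurable_const.indicator measurableSet_Icc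
  have hω0 : ∀ y, 0 ≤ ω y := fun y =>
    le_min hlam.le (add_nonneg (hb0 y) (indicator_nonneg (fun _ _ => hlam.le) y))
  have hωlam : ∀ y, ω y ≤ lam := fun y => min_le_left _ _
  have hωin : ∀ y, |y| ≤ N → ω y = lam := fun y hy => by
    simp only [ω]
    rw [indicator_of_mem (show y ∈ Icc (-N) N from abs_le.1 hy)]
    exact min_eq_left (by linarith [hb0 y])
  have hωout : ∀ y, N < |y| → ω y = min lam (b y) := fun y hy => by
    simp only [ω]
    rw [indicator_of_notMem (show y ∉ Icc (-N) N from fun h => not_lt.2 (abs_le.2 h) hy), add_zero]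
  have hωb : ∀ y, r < |y| → ω y ≤ b y := fun y hy => by
    rcases le_or_gt |y| N with h1 | h1
    · rw [hωin y h1]
      rcases le_total 0 y with h2 | h2
      · rw [abs_of_nonneg h2] at hy h1
        exact hlamN.trans (hanti.antitoneOn (hrρ₁.trans_lt hy) (hrρ₁.trans_lt hNr) h1)
      · rw [abs_of_nonpos h2] at hy h1
        have := hanti'.antitoneOn (hrρ₂.trans_lt hy) (hrρ₂.trans_lt hNr) h1
        simp only [neg_neg] at this
        exact hlamN'.trans this
    · rw [hωout y h1]
      exact min_le_right _ _
  have hconvlam : ∀ x, convol a ω x ≤ lam := fun x => by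
    have h1 : convol a ω x ≤ convol a (fun _ => lam) x :=
      convol_mono hdata.a_nonneg
        (integrable_convol hdata.a_integrable hωm (C := lam)
          (ae_of_all _ fun y => by
            rw [Real.norm_eq_abs, abs_of_nonneg (hω0 _)]
            exact hωlam y) x)
        ((hdata.a_integrable.comp_sub_left x).mul_const _) (ae_of_all _ hωlam)
    rwa [convol_const, hdata.a_integral, one_mul] at h1
  have hconvb : ∀ x, N < |x| → convol a ω x ≤ (1 + δ) * b x := fun x hx => by
    rcases lt_abs.1 hx with h1 | h1
    · exact hconv₁ ω hωm hω0 (fun y => (hωlam y).trans hlamle₁) hωb x (hN₁.trans h1.le)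
    · have h2 := hconv₂ (fun y => ω (-y)) (hωm.comp_quasiMeasurePreserving hneg)
        (fun y => hω0 _) (fun y => (hωlam _).trans hlamle₂)
        (fun y hy => hωb (-y) (by rwa [abs_neg])) (-x) (hN₂.trans h1.le)
      rwa [convol_neg_comp, neg_neg] at h2
  refine tendsto_essSup_of_profile hdata hu (mul_pos hβ hε) (C := max 1 (θ / lam)) (by positivity)
    hωm hω0 hωlam (fun x => ?_) ?_ (fun _ => measurableSet_Icc) ?_
  · have hlamδ : lam ≤ (1 + δ) * lam := le_mul_of_one_le_left hlam.le (by linarith)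
    rcases le_or_gt |x| N with hx | hx
    · rw [hωin x hx]
      exact (hconvlam x).trans hlamδ
    · rw [hωout x hx, mul_min_of_nonneg _ _ (by linarith)]
      -- A minimum inherits the inequality: `a * ω` is bounded both by `lam` and by `(1 + δ) b`.
      exact le_min ((hconvlam x).trans hlamδ) (hconvb x hx)
  · filter_upwards [hmax, ae_le_of_le_constE hu₀θ] with x h1 h2
    have h3 : u₀ x ≤ max 1 (θ / lam) * lam :=
      calc u₀ x ≤ θ := h2
        _ = θ / lam * lam := by field_simp
        _ ≤ _ := mul_le_mul_of_nonneg_right (le_max_right _ _) hlam.le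
    rcases le_or_gt |x| N with hx | hx
    · rwa [hωin x hx]
    · rw [hωout x hx, mul_min_of_nonneg _ _ (by positivity)]
      exact le_min h3 (((le_max_right _ _).trans (h1 ((hrρ.trans_lt hNr).trans hx))).trans
        (le_mul_of_one_le_left (hb0 x) (le_max_left _ _)))
  · filter_upwards [rightFront_lt_imp hβ hd hc hε N, rightFront_lt_imp hβ hd' hc' hε N]
      with t ht ht' x hx
    have hx' : N < |x| ∧ b x ≤ Real.exp (-((κ - m) * (t + ε * t))) := by
      rcases not_and_or.1 hx with h1 | h1
      · obtain ⟨h2, h3⟩ := ht' (-x) (by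
          have : x < -leftFront (κ - m) b (t + ε * t) := not_le.1 h1
          unfold leftFront at this
          linarith)
        rw [neg_neg] at h3
        exact ⟨h2.trans_le (neg_le_abs x), h3⟩
      · obtain ⟨h2, h3⟩ := ht x (not_le.1 h1)
        exact ⟨h2.trans_le (le_abs_self x), h3⟩
    rw [hωout x hx'.1]
    exact (min_le_right _ _).trans hx'.2

end Front

end AccelFront

theorem theorem5p4 (κ m θ : ℝ) (a : ℝ → ℝ) (G : E → E) (u₀ : E) (u : ℝ → E) (b : ℝ → ℝ)
    (hdata : Data κ m a G)
    (hgrowth : GrowthPos κ m) (hbounds : GBounds κ m G θ)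
    (hlip : GLipschitz G θ) (hcomp : GComparison κ a G θ)
    (hu₀ : 0 ≤ u₀) (hu₀θ : u₀ ≤ constE θ) (hu₀_nontriv : Nontriv u₀)
    (hu : IsSolution κ m a G u₀ u)
    (hb : ∀ x, 0 ≤ b x) :
    -- integrable case: `Λ_ε⁺(t, b) = [-l(t + ε t, b), r(t + ε t, b)]`
    (DecayBoth u₀ → ClassS b →
      (∃ ρ : ℝ, 0 < ρ ∧ ∀ᵐ x, ρ < |x| → max (a x) (u₀ x) ≤ b x) →
      ∀ ε : ℝ, 0 < ε → ε < 1 →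
        Tendsto (fun t : ℝ => essSup (fun x => ‖u t x‖ₑ) (volume.restrict
          (Icc (-leftFront (κ - m) b (t + ε * t)) (rightFront (κ - m) b (t + ε * t)))ᶜ))
          atTop (𝓝 0)) ∧
    -- monotone case: `Λ_ε⁺(t, b) = (-∞, r(t + ε t, b)]`
    (DecayRight u₀ → ClassMS b →
      (∃ ρ : ℝ, 0 < ρ ∧ ∀ᵐ x, ρ < x → max (∫ y in Ioi x, a y) (u₀ x) ≤ b x) →
      ∀ ε : ℝ, 0 < ε → ε < 1 →
        Tendsto (fun t : ℝ => essSup (fun x => ‖u t x‖ₑ) (volume.restrict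
          (Iic (rightFront (κ - m) b (t + ε * t)))ᶜ))
          atTop (𝓝 0)) := by
  refine ⟨fun _ hbS ⟨ρ, _, hmax⟩ ε hε _ => ?_, fun _ hbMS ⟨ρ, _, hmax⟩ ε hε _ => ?_⟩
  · exact tendsto_essSup_of_classS hdata hgrowth hbounds.1 hu₀θ hu hb hbS hmax hε
  · exact tendsto_essSup_of_classMS hdata hgrowth hbounds.1 hu₀θ hu hb hbMS hmax hε
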